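/- Let $N\ge 1$, let $\mathcal E_1\le\dots\le\mathcal E_N$ be real numbers with $\sum_k\mathcal E_k=0$, and put $A=-i\,\mathrm{diag}(\mathcal E_1,\dots,\mathcal E_N)$. Let $B=(b_{ij})\in\mathfrak{su}(N)$, i.e. $B$ is a traceless skew-Hermitian $N\times N$ matrix. Consider the control system $$\dot X(t)=(A+u(t)B)X(t),\qquad X(t)\in SU(N),\quad X(0)=I,$$ with piecewise constant inputs $u$ taking real values. It is called controllable if every element of $SU(N)$ is of the form $X(T)$ for some such input and some $T\ge 0$. Let $\mathcal G_B$ be the graph on $\{1,\dots,N\}$ in which distinct $i,j$ are joined when $b_{ij}\ne 0$. Let $C=[A,B]$, $D=[C,B]=[[A,B],B]$, and let $D_0$ be the diagonal part of $D$. For a diagonal matrix $H=\mathrm{diag}(h_1,\dots,h_N)$ put $\alpha_{ij}(H)=h_i-h_j$. Call $H$ regular if the numbers $\alpha_{ij}(H)$, over all ordered pairs $(i,j)$ with $i\neq j$, are nonzero and pairwise distinct. For a matrix $M=(m_{ij})$, call $H$ $M$-regular if the numbers $\alpha_{ij}(H)$, over all pairs $i<j$ with $m_{ij}\ne 0$,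 are nonzero and pairwise distinct. Assume that $\mathcal E_i\neq\mathcal E_j$ for $i\ne j$ and that $\mathcal G_B$ is connected. Then $D_0=i\,\mathrm{diag}(d_1,\dots,d_N)$ with $$d_k=2\Big(\sum_{i<k}(\mathcal E_k-\mathcal E_i)|b_{ik}|^2-\sum_{i>k}(\mathcal E_i-\mathcal E_k)|b_{ki}|^2\Big),$$ and each of the following conditions is sufficient for the system to be controllable: (1) $D_0$ is regular; (2) $D_0$ is $B$-regular; (3) $D_0$ is $C$-regular. -/

import Mathlib

namespace QuantumControl

/-- The real Lie algebra `su(N)`, as a set: the traceless skew-Hermitian `N × N` matrices. -/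
def su (N : ℕ) : Set (Matrix (Fin N) (Fin N) ℂ) :=
  {M | M.conjTranspose = -M ∧ M.trace = 0}

/-- The drift `A = -i H₀`, where `H₀ = diag(E₁, …, E_N)` is the free Hamiltonian. -/
noncomputable def drift {N : ℕ} (E : Fin N → ℝ) : Matrix (Fin N) (Fin N) ℂ :=
  (-Complex.I) • Matrix.diagonal (fun k => (E k : ℂ))

/-- The graph of a (skew-Hermitian) matrix `M`: the nodes are the indices, and distinct nodes
`i`, `j` are joined when `M i j ≠ 0` (equivalently `M j i ≠ 0`, as `M` is skew-Hermitian). -/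
def graph {N : ℕ} (M : Matrix (Fin N) (Fin N) ℂ) : SimpleGraph (Fin N) :=
  SimpleGraph.fromRel (fun i j => M i j ≠ 0)

/-- The value at the diagonal matrix `H` of the root `α_{ij} = α_i - α_j`,
where `α_i (diag (l₁, …, l_N)) = l_i`. -/
def root {N : ℕ} (i j : Fin N) (H : Matrix (Fin N) (Fin N) ℂ) : ℂ :=
  H i i - H j j

/-- A diagonal matrix `H` is regular: all the roots `α_{ij}`, `i ≠ j`, positive and negative,
take nonzero and pairwise distinct values at `H`. -/
def IsRegular {N : ℕ} (H : Matrix (Fin N) (Fin N) ℂ) : Prop :=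
  (∀ i j : Fin N, i ≠ j → root i j H ≠ 0) ∧
  ∀ i j k l : Fin N, i ≠ j → k ≠ l → (i, j) ≠ (k, l) → root i j H ≠ root k l H

/-- The set `Γ⁺` of the positive roots `α_{ij}`, `i < j`, that are touched by `M`. -/
def posRoots {N : ℕ} (M : Matrix (Fin N) (Fin N) ℂ) : Set (Fin N × Fin N) :=
  {p | p.1 < p.2 ∧ M p.1 p.2 ≠ 0}

/-- A diagonal matrix `H` is `M`-regular: the roots in the set `Γ⁺` of `M` take nonzero and
pairwise distinct values at `H`. -/
def IsRegularAlong {N : ℕ} (M H : Matrix (Fin N) (Fin N) ℂ) : Prop :=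
  (∀ p ∈ posRoots M, root p.1 p.2 H ≠ 0) ∧
  ∀ p ∈ posRoots M, ∀ q ∈ posRoots M, p ≠ q → root p.1 p.2 H ≠ root q.1 q.2 H

/-- The level one bracket `C = [A, B]`. -/
def levelOne {N : ℕ} (A B : Matrix (Fin N) (Fin N) ℂ) : Matrix (Fin N) (Fin N) ℂ :=
  ⁅A, B⁆

/-- The level two bracket `D = [C, B] = [[A, B], B]`. -/
def levelTwo {N : ℕ} (A B : Matrix (Fin N) (Fin N) ℂ) : Matrix (Fin N) (Fin N) ℂ :=
  ⁅levelOne A B, B⁆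

/-- The diagonal part `D₀` of the level two bracket `D`. -/
def levelTwoDiag {N : ℕ} (A B : Matrix (Fin N) (Fin N) ℂ) : Matrix (Fin N) (Fin N) ℂ :=
  Matrix.diagonal (levelTwo A B).diag

/-- `d_k = 2 (∑_{i<k} (E_k - E_i) |b_{ik}|² - ∑_{i>k} (E_i - E_k) |b_{ki}|²)`. -/
noncomputable def dEntry {N : ℕ} (E : Fin N → ℝ) (B : Matrix (Fin N) (Fin N) ℂ) (k : Fin N) : ℝ :=
  2 * (∑ i ∈ Finset.univ.filter (fun i => i < k), (E k - E i) * ‖B i k‖ ^ 2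
    - ∑ i ∈ Finset.univ.filter (fun i => k < i), (E i - E k) * ‖B k i‖ ^ 2)

/-- The admissible inputs: piecewise constant real functions (with finitely many pieces).
A larger class of inputs could only enlarge the reachable set, so controllability with these
inputs is the strongest form of controllability. -/
def IsAdmissible (u : ℝ → ℝ) : Prop :=
  ∃ S : Finset ℝ, ∀ s t : ℝ, s ≤ t → (∀ r ∈ S, r ∉ Set.Icc s t) → u s = u t

/-- `X : [0, T] → SU(N)` is an integral curve of `X' = (A + u(t) B) X`, `X(0) = I`: it is
continuous on `[0, T]`, and the differential equation holds (entry by entry) at all times in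
`(0, T)` outside a finite set. The values of `X` outside `[0, T]` are irrelevant. -/
def IsIntegralCurve {N : ℕ} (A B : Matrix (Fin N) (Fin N) ℂ) (u : ℝ → ℝ) (T : ℝ)
    (X : ℝ → Matrix.specialUnitaryGroup (Fin N) ℂ) : Prop :=
  X 0 = 1 ∧ ContinuousOn X (Set.Icc 0 T) ∧
  ∃ S : Finset ℝ, ∀ t ∈ Set.Ioo 0 T, t ∉ S → ∀ i j : Fin N,
    HasDerivAt (fun s : ℝ => (X s : Matrix (Fin N) (Fin N) ℂ) i j)
      (((A + (u t : ℂ) • B) * (X t : Matrix (Fin N) (Fin N) ℂ)) i j) t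

/-- The reachable set from the identity, in arbitrary time `T ≥ 0`. -/
def reachableSet {N : ℕ} (A B : Matrix (Fin N) (Fin N) ℂ) :
    Set (Matrix.specialUnitaryGroup (Fin N) ℂ) :=
  {Y | ∃ u : ℝ → ℝ, IsAdmissible u ∧ ∃ T : ℝ, 0 ≤ T ∧
    ∃ X : ℝ → Matrix.specialUnitaryGroup (Fin N) ℂ, IsIntegralCurve A B u T X ∧ X T = Y}

/-- The system `X' = (A + u(t) B) X`, `X(0) = I`, on `SU(N)` is (globally) controllable:
its reachable set is all of `SU(N)`. -/
def IsControllable {N : ℕ} (A B : Matrix (Fin N) (Fin N) ℂ) : Prop :=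
  reachableSet A B = Set.univ

end QuantumControl

/-! Two facts combine. Algebraic: `drift E` and `B` generate a real Lie algebra containing su(N).
The projections used below need complex coefficients, so one works in L + iL; a skew-Hermitian
element of L + iL already lies in L. Elementary matrices are eigenvectors of ad H for diagonal H,
and polynomials in ad H realise every function of the root values. Projecting D to the kernel of ad
A yields D₀, as the energies are distinct. For an edge (i,j), projecting B to the eigenspace of its
energy gap keeps only entries oriented like (i,j); then D₀, whose values need only separate positive
roots, isolates the elementary matrix at (i,j). Connectedness propagates these to all traceless
matrices (`su_subset_lieSpan`). Conditions (1) and (3) reduce to (2).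

Analytic: the rank condition gives controllability although time runs only forward. The monoid S of
forward flows contains a strictly differentiable family whose derivative covers su(N)
(`exists_hasLocalParam`), hence S has interior in SU(N) (`HasLocalParam.exists_ball`). Recurrence of
powers in a compact group carries the interior point to the identity, and exponentials then fill
SU(N) (`specialUnitaryGroup_le_of_ball`). -/

namespace QuantumControl

open Matrix

attribute [local instance] LieRing.ofAssociativeRing

/-! ### Generating su(N) from A and B -/

section LieGeneration

variable {N : ℕ}

/-- The complexification `L + iL` of a real Lie subalgebra `L` of `gl(N, ℂ)`. -/
def complexify (L : LieSubalgebra ℝ (Matrix (Fin N) (Fin N) ℂ)) :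
    LieSubalgebra ℂ (Matrix (Fin N) (Fin N) ℂ) where
  carrier := {X | ∃ a ∈ L, ∃ b ∈ L, X = a + Complex.I • b}
  zero_mem' := ⟨0, L.zero_mem, 0, L.zero_mem, by simp⟩
  add_mem' := by
    rintro _ _ ⟨a, ha, b, hb, rfl⟩ ⟨a', ha', b', hb', rfl⟩
    exact ⟨_, L.add_mem ha ha', _, L.add_mem hb hb', by module⟩
  smul_mem' := by
    rintro z _ ⟨a, ha, b, hb, rfl⟩
    refine ⟨z.re • a - z.im • b, L.sub_mem (L.smul_mem _ ha) (L.smul_mem _ hb),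
      z.re • b + z.im • a, L.add_mem (L.smul_mem _ hb) (L.smul_mem _ ha), ?_⟩
    ext i j
    apply Complex.ext <;> simp <;> ring
  lie_mem' := by
    rintro _ _ ⟨a, ha, b, hb, rfl⟩ ⟨a', ha', b', hb', rfl⟩
    refine ⟨⁅a, a'⁆ - ⁅b, b'⁆, L.sub_mem (L.lie_mem ha ha') (L.lie_mem hb hb'),
      ⁅a, b'⁆ + ⁅b, a'⁆, L.add_mem (L.lie_mem ha hb') (L.lie_mem hb ha'), ?_⟩
    simp only [add_lie, lie_add, smul_lie, lie_smul, smul_add, smul_smul, Complex.I_mul_I]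
    module

theorem mem_complexify_of_mem {L : LieSubalgebra ℝ (Matrix (Fin N) (Fin N) ℂ)}
    {X : Matrix (Fin N) (Fin N) ℂ} (hX : X ∈ L) : X ∈ complexify L :=
  ⟨X, hX, 0, L.zero_mem, by simp⟩

/-- A skew-Hermitian element of the complexification of a skew-Hermitian Lie algebra `L` is
already in `L`. -/
theorem mem_of_mem_complexify {L : LieSubalgebra ℝ (Matrix (Fin N) (Fin N) ℂ)}
    (hL : ∀ X ∈ L, Xᴴ = -X) {X : Matrix (Fin N) (Fin N) ℂ} (hX : Xᴴ = -X)
    (h : X ∈ complexify L) : X ∈ L := by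
  obtain ⟨a, ha, b, hb, rfl⟩ := h
  -- Since a and b are skew-Hermitian, i b is the Hermitian part of a + i b, and it must vanish.
  have h0 : (2 * Complex.I) • b = 0 := by
    have h1 := hX
    rw [conjTranspose_add, conjTranspose_smul, hL a ha, hL b hb] at h1
    simp only [Complex.star_def, Complex.conj_I] at h1
    have h2 : (-a + (-Complex.I) • -b) + (a + Complex.I • b) = 0 := by rw [h1]; abel
    rw [← h2]; module
  have : b = 0 := by
    rcases smul_eq_zero.1 h0 with h | h
    · simp at h
    · exact h
  simpa [this] using ha

theorem lie_diagonal_apply (h : Fin N → ℂ) (X : Matrix (Fin N) (Fin N) ℂ) (i j : Fin N) :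
    ⁅diagonal h, X⁆ i j = (h i - h j) * X i j := by
  rw [Ring.lie_def, Matrix.sub_apply, diagonal_mul, mul_diagonal]; ring

/-- Functional calculus of `ad H` for diagonal `H`. -/
theorem of_root_mul_mem {L : LieSubalgebra ℂ (Matrix (Fin N) (Fin N) ℂ)} {h : Fin N → ℂ}
    (hL : diagonal h ∈ L) {X : Matrix (Fin N) (Fin N) ℂ} (hX : X ∈ L) (f : ℂ → ℂ) :
    (of fun i j => f (h i - h j) * X i j) ∈ L := by
  have key : ∀ p : Polynomial ℂ, (of fun i j => p.eval (h i - h j) * X i j) ∈ L := by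
    intro p
    induction p using Polynomial.induction_on with
    | C a =>
      have := L.smul_mem a hX
      convert this using 1
      ext i j; simp
    | add p q hp hq =>
      convert L.add_mem hp hq using 1
      ext i j; simp [add_mul]
    | monomial n a ih =>
      convert L.lie_mem hL ih using 1
      ext i j
      rw [lie_diagonal_apply]
      simp only [of_apply, Polynomial.eval_mul, Polynomial.eval_C, Polynomial.eval_pow,
        Polynomial.eval_X]
      ring
  classical
  set s : Finset ℂ := Finset.univ.image fun p : Fin N × Fin N => h p.1 - h p.2
  -- Only finitely many root values occur, so f agrees on them with an interpolating polynomial.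
  convert key (Lagrange.interpolate s id f) using 1
  ext i j
  have := Lagrange.eval_interpolate_at_node (s := s) (v := id) f (i := h i - h j)
    (Set.injOn_id _) (Finset.mem_image_of_mem _ (Finset.mem_univ (i, j)))
  simp only [id] at this
  simp only [of_apply]
  rw [← this]

/-- A complex Lie algebra that contains the elementary matrices along the edges of a connected
graph contains all traceless matrices. -/
theorem traceless_mem_of_connected {L : LieSubalgebra ℂ (Matrix (Fin N) (Fin N) ℂ)}
    {G : SimpleGraph (Fin N)} (hG : G.Connected)
    (hL : ∀ i j, G.Adj i j → single i j (1 : ℂ) ∈ L)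
    {X : Matrix (Fin N) (Fin N) ℂ} (hX : X.trace = 0) : X ∈ L := by
  have key : ∀ i j, i ≠ j → single i j (1 : ℂ) ∈ L := by
    intro i j
    obtain ⟨w⟩ := hG.preconnected i j
    induction w with
    | nil => intro h; exact absurd rfl h
    | @cons u v w h p ih =>
      intro huw
      rcases eq_or_ne v w with rfl | hvw
      · exact hL _ _ h
      · have := L.lie_mem (hL _ _ h) (ih hvw)
        rw [Ring.lie_def, single_mul_single_same, single_mul_single_of_ne _ _ _ _ huw.symm] at this
        simpa using this
  obtain ⟨o⟩ := hG.nonempty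
  have hd : ∀ i, single i i (1 : ℂ) - single o o 1 ∈ L := by
    intro i
    rcases eq_or_ne i o with rfl | hi
    · simp
    · have := L.lie_mem (key _ _ hi) (key _ _ hi.symm)
      rw [Ring.lie_def, single_mul_single_same, single_mul_single_same] at this
      simpa using this
  -- The subtracted terms add up to the trace of X times one elementary matrix, which is zero.
  have hsum : X = ∑ i, ∑ j, X i j • (single i j (1 : ℂ) - if i = j then single o o 1 else 0) := by
    simp only [smul_sub, Finset.sum_sub_distrib, smul_ite, smul_zero, Finset.sum_ite_eq,
      Finset.mem_univ, if_true, ← Finset.sum_smul]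
    have : ∑ i, X i i = 0 := hX
    rw [this, zero_smul, sub_zero]
    conv_lhs => rw [matrix_eq_sum_single X]
    simp
  rw [hsum]
  refine L.toSubmodule.sum_mem fun i _ => L.toSubmodule.sum_mem fun j _ =>
    L.toSubmodule.smul_mem _ ?_
  rcases eq_or_ne i j with rfl | hij
  · simpa using hd i
  · simpa [hij] using key _ _ hij

theorem graph_adj_iff {M : Matrix (Fin N) (Fin N) ℂ} (hM : Mᴴ = -M) {i j : Fin N} :
    (graph M).Adj i j ↔ i ≠ j ∧ M i j ≠ 0 := by
  have h : M j i = 0 ↔ M i j = 0 := by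
    have := congrFun₂ hM j i
    simp only [conjTranspose_apply, Matrix.neg_apply] at this
    rw [← star_eq_zero (x := M i j), this, neg_eq_zero]
  simp [graph, SimpleGraph.fromRel_adj, h]

theorem drift_eq_diagonal (E : Fin N → ℝ) :
    drift E = diagonal fun k => -Complex.I * (E k : ℂ) := by
  ext i j
  by_cases h : i = j <;> simp [drift, diagonal, h]

theorem drift_mem_su {E : Fin N → ℝ} (hE : ∑ k, E k = 0) : drift E ∈ su N := by
  constructor
  · rw [drift_eq_diagonal, diagonal_conjTranspose, diagonal_neg]
    congr 1
    ext k
    simp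
  · rw [drift_eq_diagonal, trace_diagonal, ← Finset.mul_sum, ← Complex.ofReal_sum, hE]
    simp

/-- `su(N)` as a real Lie subalgebra of `gl(N, ℂ)`. -/
def suLie (N : ℕ) : LieSubalgebra ℝ (Matrix (Fin N) (Fin N) ℂ) where
  carrier := su N
  zero_mem' := by simp [su]
  add_mem' := by
    rintro X Y ⟨hX, hX'⟩ ⟨hY, hY'⟩
    exact ⟨by rw [conjTranspose_add, hX, hY]; abel, by rw [trace_add, hX', hY', add_zero]⟩
  smul_mem' := by
    rintro r X ⟨hX, hX'⟩
    exact ⟨by rw [conjTranspose_smul, hX]; simp, by rw [trace_smul, hX', smul_zero]⟩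
  lie_mem' := by
    rintro X Y ⟨hX, hX'⟩ ⟨hY, hY'⟩
    exact ⟨by simp [Ring.lie_def, hX, hY],
      by rw [Ring.lie_def, trace_sub, trace_mul_comm, sub_self]⟩

/-- If `D₀` is `B`-regular, the system satisfies the Lie algebra rank condition. -/
theorem su_subset_lieSpan {E : Fin N → ℝ} {B : Matrix (Fin N) (Fin N) ℂ}
    (hE : ∑ k, E k = 0) (hmono : StrictMono E) (hB : B ∈ su N) (hG : (graph B).Connected)
    (hreg : IsRegularAlong B (levelTwoDiag (drift E) B)) :
    su N ⊆ LieSubalgebra.lieSpan ℝ (Matrix (Fin N) (Fin N) ℂ) {drift E, B} := by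
  set L := LieSubalgebra.lieSpan ℝ (Matrix (Fin N) (Fin N) ℂ) {drift E, B}
  have hA : drift E ∈ L := LieSubalgebra.subset_lieSpan (by simp)
  have hB' : B ∈ L := LieSubalgebra.subset_lieSpan (by simp)
  have hLsu : L ≤ suLie N := LieSubalgebra.lieSpan_le.2 (by
    rintro X (rfl | rfl)
    · exact drift_mem_su hE
    · exact hB)
  have hinj : ∀ i j, -Complex.I * (E i : ℂ) - -Complex.I * (E j : ℂ) = 0 ↔ i = j := by
    intro i j
    rw [← mul_sub, mul_eq_zero, sub_eq_zero, Complex.ofReal_inj, hmono.injective.eq_iff]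
    simp
  have hAc := mem_complexify_of_mem hA
  have hBc := mem_complexify_of_mem hB'
  have hDc : levelTwo (drift E) B ∈ complexify L :=
    mem_complexify_of_mem (L.lie_mem (L.lie_mem hA hB') hB')
  rw [drift_eq_diagonal] at hAc
  have hD0 : levelTwoDiag (drift E) B ∈ complexify L := by
    classical
    convert of_root_mul_mem hAc hDc (fun z => if z = 0 then 1 else 0) using 1
    ext i j
    simp only [levelTwoDiag, of_apply, hinj, diagonal_apply, diag_apply]
    split_ifs with h
    · subst h; simp
    · simp
  intro X hX
  refine mem_of_mem_complexify (fun X hX => (hLsu hX).1) hX.1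
    (traceless_mem_of_connected hG ?_ hX.2)
  intro i j hij
  obtain ⟨hne, hb⟩ := (graph_adj_iff hB.1).1 hij
  classical
  set d := (levelTwo (drift E) B).diag
  -- Keep the entries of B whose energy gap equals that of (i,j), then those with the same root
  -- value at D₀; the factor `(B i j)⁻¹` normalises the survivor.
  have h1 := of_root_mul_mem hAc hBc
    (fun z => if z = -Complex.I * (E i : ℂ) - -Complex.I * (E j : ℂ) then 1 else 0)
  have h2 := of_root_mul_mem (h := d) hD0 h1 (fun z => if z = d i - d j then (B i j)⁻¹ else 0)
  convert h2 using 1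
  ext k l
  simp only [of_apply, single_apply]
  have hroot : ∀ k l, root k l (levelTwoDiag (drift E) B) = d k - d l := by
    intro k l; simp [root, levelTwoDiag, d]
  have hskew : ∀ k l, B k l ≠ 0 → B l k ≠ 0 := by
    intro k l h h'
    have := congrFun₂ hB.1 k l
    simp only [conjTranspose_apply, Matrix.neg_apply, h', star_zero] at this
    exact h (by simpa using this.symm)
  by_cases hkl : i = k ∧ j = l
  · obtain ⟨rfl, rfl⟩ := hkl
    simp [hb]
  · rw [if_neg hkl]
    split_ifs with hd ha <;> simp only [mul_zero, zero_mul, one_mul]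
    suffices B k l = 0 by rw [this]; simp
    by_contra hB0
    apply hkl
    have hE' : E k - E l = E i - E j := by
      rw [← mul_sub, ← mul_sub] at ha
      have := mul_left_cancel₀ (by simp) ha
      exact_mod_cast this
    -- Equal energy gaps force (k,l) to have the orientation of (i,j), so distinctness on positive
    -- roots suffices; for i > j both pairs are reversed.
    rcases lt_or_gt_of_ne hne with h | h
    · have hkl' : k < l := hmono.lt_iff_lt.1 (by linarith [hmono h])
      by_contra hc
      exact hreg.2 (i, j) ⟨h, hb⟩ (k, l) ⟨hkl', hB0⟩ (by simpa using hc)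
        (by rw [hroot, hroot]; exact hd.symm)
    · have hkl' : l < k := hmono.lt_iff_lt.1 (by linarith [hmono h])
      by_contra hc
      exact hreg.2 (j, i) ⟨h, hskew _ _ hb⟩ (l, k) ⟨hkl', hskew _ _ hB0⟩
        (by simpa [and_comm] using hc)
        (by rw [hroot, hroot]; linear_combination hd)

end LieGeneration

/-! ### The diagonal part of D, and reduction to condition (2) -/

section DiagonalFormula

variable {N : ℕ}

/-- Bracketing with A multiplies entry (k,i) by -i(E_k - E_i), which is antisymmetric in the
indices, so the two products in [C,B]_kk contribute equally, whence the factor 2; skewness gives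
b_ki b_ik = -|b_ik|². -/
theorem levelTwoDiag_drift (E : Fin N → ℝ) {B : Matrix (Fin N) (Fin N) ℂ} (hB : Bᴴ = -B) :
    levelTwoDiag (drift E) B = Complex.I • diagonal (fun k => (dEntry E B k : ℂ)) := by
  have hB' : ∀ i j, B j i = -star (B i j) := fun i j => by
    have := congrFun₂ hB j i
    simp only [conjTranspose_apply, Matrix.neg_apply] at this
    rw [this, neg_neg]
  have hn : ∀ i j, ‖B j i‖ = ‖B i j‖ := fun i j => by rw [hB' i j]; simp
  have hterm : ∀ i k, B k i * B i k = -((‖B i k‖ ^ 2 : ℝ) : ℂ) := fun i k => by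
    rw [hB' i k, Complex.star_def, neg_mul, ← Complex.normSq_eq_conj_mul_self,
      Complex.normSq_eq_norm_sq]
  have hd : ∀ k, dEntry E B k = 2 * ∑ i, (E k - E i) * ‖B i k‖ ^ 2 := by
    intro k
    rw [dEntry, sub_eq_add_neg, ← Finset.sum_neg_distrib, Finset.sum_filter, Finset.sum_filter,
      ← Finset.sum_add_distrib]
    congr 1
    refine Finset.sum_congr rfl fun i _ => ?_
    rcases lt_trichotomy i k with h | rfl | h
    · simp [h, h.le]
    · simp
    · simp only [h, h.not_gt, if_true, if_false, hn k i]; ring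
  rw [← diagonal_smul]
  unfold levelTwoDiag
  congr 1
  ext k
  simp only [diag_apply, Pi.smul_apply, smul_eq_mul, hd]
  rw [levelTwo, Ring.lie_def, Matrix.sub_apply, Matrix.mul_apply, Matrix.mul_apply,
    ← Finset.sum_sub_distrib]
  push_cast
  rw [Finset.mul_sum, Finset.mul_sum]
  refine Finset.sum_congr rfl fun i _ => ?_
  have := hterm i k
  push_cast at this
  rw [levelOne, drift_eq_diagonal, lie_diagonal_apply, lie_diagonal_apply]
  linear_combination (-2 * Complex.I * (E k - E i)) * this

theorem isRegularAlong_of_isRegular {M H : Matrix (Fin N) (Fin N) ℂ} (h : IsRegular H) :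
    IsRegularAlong M H :=
  ⟨fun _ hp => h.1 _ _ hp.1.ne, fun _ hp _ hq hpq => h.2 _ _ _ _ hp.1.ne hq.1.ne hpq⟩

theorem posRoots_levelOne {E : Fin N → ℝ} (hE : Function.Injective E)
    (B : Matrix (Fin N) (Fin N) ℂ) : posRoots (levelOne (drift E) B) = posRoots B := by
  ext ⟨i, j⟩
  simp only [posRoots, Set.mem_ofPred_eq, levelOne, drift_eq_diagonal, lie_diagonal_apply]
  refine and_congr_right fun hij => ?_
  have : -Complex.I * (E i : ℂ) - -Complex.I * (E j : ℂ) ≠ 0 := by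
    rw [← mul_sub]
    simpa [sub_eq_zero, hE.eq_iff] using hij.ne
  rw [mul_ne_zero_iff, and_iff_right this]

end DiagonalFormula

/-! ### Exponentials and the special unitary group -/

section SpecialUnitary

open scoped Matrix.Norms.L2Operator

variable {N : ℕ}

theorem smul_mem_su {X : Matrix (Fin N) (Fin N) ℂ} (hX : X ∈ su N) (t : ℝ) : t • X ∈ su N :=
  (suLie N).smul_mem t hX

theorem star_exp_of_skew {X : Matrix (Fin N) (Fin N) ℂ} (hX : Xᴴ = -X) :
    star (NormedSpace.exp X) = NormedSpace.exp (-X) := by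
  rw [NormedSpace.star_exp, star_eq_conjTranspose, hX]

theorem exp_neg_mul_exp (X : Matrix (Fin N) (Fin N) ℂ) :
    NormedSpace.exp (-X) * NormedSpace.exp X = 1 := by
  rw [← Matrix.exp_add_of_commute _ _ (Commute.neg_left (Commute.refl X)), neg_add_cancel,
    NormedSpace.exp_zero]

theorem exp_mem_unitaryGroup {X : Matrix (Fin N) (Fin N) ℂ} (hX : Xᴴ = -X) :
    NormedSpace.exp X ∈ unitaryGroup (Fin N) ℂ := by
  rw [mem_unitaryGroup_iff', star_exp_of_skew hX, exp_neg_mul_exp]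

/-- The matrix iX is Hermitian, so X is unitarily diagonalisable and the identity reduces to
diagonal matrices. -/
theorem det_exp_of_skew {X : Matrix (Fin N) (Fin N) ℂ} (hX : Xᴴ = -X) :
    (NormedSpace.exp X).det = Complex.exp X.trace := by
  have hH : (Complex.I • X).IsHermitian := by
    rw [IsHermitian, conjTranspose_smul, hX]; simp
  set U : Matrix (Fin N) (Fin N) ℂ := hH.eigenvectorUnitary.1
  set v : Fin N → ℂ := fun k => -Complex.I * (hH.eigenvalues k : ℂ)
  have hU : U * star U = 1 := Unitary.mul_star_self_of_mem hH.eigenvectorUnitary.2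
  have hUinv : U⁻¹ = star U := inv_eq_right_inv hU
  have hUu : IsUnit U := IsUnit.of_mul_eq_one _ hU
  have hdet : IsUnit U.det := (isUnit_iff_isUnit_det _).1 hUu
  have hXd : X = U * diagonal v * U⁻¹ := by
    have h := hH.spectral_theorem
    rw [Unitary.conjStarAlgAut_apply] at h
    have h' : X = (-Complex.I) • (Complex.I • X) := by simp [smul_smul]
    have hv : diagonal v = (-Complex.I) • diagonal (RCLike.ofReal ∘ hH.eigenvalues) := by
      rw [← diagonal_smul]; rfl
    rw [h', h, hUinv, hv, mul_smul_comm, smul_mul_assoc]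
  rw [hXd, Matrix.exp_conj _ _ hUu, Matrix.exp_diagonal, det_mul, det_mul, mul_right_comm,
    ← det_mul, mul_nonsing_inv _ hdet, det_one, one_mul, det_diagonal, trace_mul_comm,
    ← mul_assoc, nonsing_inv_mul _ hdet, one_mul, trace_diagonal, Complex.exp_sum]
  refine Finset.prod_congr rfl fun k _ => ?_
  rw [Pi.coe_exp, Complex.exp_eq_exp_ℂ]

theorem exp_mem_specialUnitaryGroup {X : Matrix (Fin N) (Fin N) ℂ} (hX : X ∈ su N) :
    NormedSpace.exp X ∈ specialUnitaryGroup (Fin N) ℂ :=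
  mem_specialUnitaryGroup_iff.2
    ⟨exp_mem_unitaryGroup hX.1, by rw [det_exp_of_skew hX.1, hX.2, Complex.exp_zero]⟩

/-- The logarithm is i arg(U) by functional calculus. The jump of arg is harmless because the
spectrum is finite. -/
theorem exists_skew_exp_eq {U : Matrix (Fin N) (Fin N) ℂ} (hU : U ∈ unitaryGroup (Fin N) ℂ) :
    ∃ X : Matrix (Fin N) (Fin N) ℂ, Xᴴ = -X ∧ NormedSpace.exp X = U := by
  have hU' : U ∈ unitary (Matrix (Fin N) (Fin N) ℂ) := hU
  have hfin : (spectrum ℂ U).Finite := Matrix.finite_spectrum U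
  have hcont : ∀ f : ℂ → ℂ, ContinuousOn f (spectrum ℂ U) := fun f => hfin.continuousOn f
  have hnorm : IsStarNormal U :=
    ⟨by rw [Commute, SemiconjBy, (Unitary.mem_iff.1 hU').1, (Unitary.mem_iff.1 hU').2]⟩
  set H := cfc (Complex.ofReal ∘ Complex.arg : ℂ → ℂ) U
  have hH : IsSelfAdjoint H := IsSelfAdjoint.cfc_arg U
  refine ⟨Complex.I • H, ?_, ?_⟩
  · rw [conjTranspose_smul, ← star_eq_conjTranspose, hH.star_eq]; simp
  · have hIH : Complex.I • H = cfc (fun z : ℂ => Complex.I • (Complex.arg z : ℂ)) U :=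
      (cfc_smul Complex.I (Complex.ofReal ∘ Complex.arg) U (hcont _)).symm
    rw [hIH, ← CFC.complex_exp_eq_normedSpace_exp (cfc_predicate _ U),
      ← cfc_comp' Complex.exp _ U Complex.continuous_exp.continuousOn (hcont _)]
    conv_rhs => rw [← cfc_id' ℂ U]
    refine cfc_congr fun z hz => ?_
    have h1 : ‖z‖ = 1 := spectrum.norm_eq_one_of_unitary hU' hz
    have := Complex.norm_mul_exp_arg_mul_I z
    rw [h1, Complex.ofReal_one, one_mul] at this
    simpa [mul_comm] using this

/-- Every special unitary matrix is a product of two exponentials of elements of `su(N)`. -/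
theorem exists_su_exp_mul_exp_eq {U : Matrix (Fin N) (Fin N) ℂ}
    (hU : U ∈ specialUnitaryGroup (Fin N) ℂ) :
    ∃ X ∈ su N, ∃ Y ∈ su N, NormedSpace.exp X * NormedSpace.exp Y = U := by
  obtain ⟨hU1, hU2⟩ := mem_specialUnitaryGroup_iff.1 hU
  obtain ⟨Z, hZ, rfl⟩ := exists_skew_exp_eq hU1
  rw [det_exp_of_skew hZ, Complex.exp_eq_one_iff] at hU2
  obtain ⟨m, hm⟩ := hU2
  rcases Nat.eq_zero_or_pos N with rfl | hN
  · exact ⟨0, (suLie 0).zero_mem, 0, (suLie 0).zero_mem, Subsingleton.elim _ _⟩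
  let o : Fin N := ⟨0, hN⟩
  -- The trace of Z is in 2πiℤ, so exp D = 1. With c = tr Z / N, both Z - c and c - D are traceless
  -- and their exponentials multiply to exp Z; two factors avoid choosing D to commute with Z.
  let D : Matrix (Fin N) (Fin N) ℂ := diagonal (Pi.single o Z.trace)
  have hDstar : star Z.trace = -Z.trace := by rw [← trace_conjTranspose, hZ, trace_neg]
  have hD : Dᴴ = -D := by
    rw [diagonal_conjTranspose, diagonal_neg]
    congr 1
    ext k
    by_cases h : k = o
    · subst h; simpa using hDstar
    · simp [h]
  have hDexp : NormedSpace.exp D = 1 := by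
    rw [Matrix.exp_diagonal, ← diagonal_one]
    congr 1
    ext k
    rw [Pi.coe_exp, ← Complex.exp_eq_exp_ℂ]
    by_cases h : k = o
    · subst h; simpa [Complex.exp_eq_one_iff] using ⟨m, hm⟩
    · simp [h]
  set c : ℂ := Z.trace / N
  have hN' : (N : ℂ) ≠ 0 := by exact_mod_cast hN.ne'
  have hc : (c • (1 : Matrix (Fin N) (Fin N) ℂ))ᴴ = -(c • 1) := by
    rw [conjTranspose_smul, conjTranspose_one, ← neg_smul]
    simp only [c, star_div₀, hDstar, star_natCast, neg_div]
  have htr : (c • (1 : Matrix (Fin N) (Fin N) ℂ)).trace = Z.trace := by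
    rw [trace_smul, trace_one, Fintype.card_fin, smul_eq_mul, div_mul_cancel₀ _ hN']
  have hDtr : D.trace = Z.trace := by simp [D, trace_diagonal]
  have hcomm : ∀ M : Matrix (Fin N) (Fin N) ℂ, Commute M (c • 1) := fun M =>
    (Commute.one_right M).smul_right c
  refine ⟨Z - c • 1, ⟨?_, ?_⟩, c • 1 - D, ⟨?_, ?_⟩, ?_⟩
  · rw [conjTranspose_sub, hZ, hc]; abel
  · rw [trace_sub, htr, sub_self]
  · rw [conjTranspose_sub, hD, hc]; abel
  · rw [trace_sub, htr, hDtr, sub_self]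
  · have h1 : NormedSpace.exp (c • 1 - D) = NormedSpace.exp (c • (1 : Matrix _ _ ℂ)) := by
      conv_rhs => rw [← sub_add_cancel (c • (1 : Matrix _ _ ℂ)) D]
      rw [Matrix.exp_add_of_commute _ _ ((hcomm D).symm.sub_left (Commute.refl D)), hDexp, mul_one]
    rw [h1, ← Matrix.exp_add_of_commute _ _ (hcomm _), sub_add_cancel]

end SpecialUnitary

/-! ### Directions reachable by forward flows -/

section FlowMonoid

open scoped Matrix.Norms.L2Operator Topology

variable {N : ℕ} {A B : Matrix (Fin N) (Fin N) ℂ}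

/-- The monoid generated by the forward flows `exp (t (A + u B))`, `t ≥ 0`. -/
noncomputable def flowMonoid (A B : Matrix (Fin N) (Fin N) ℂ) :
    Submonoid (Matrix (Fin N) (Fin N) ℂ) :=
  Submonoid.closure {Y | ∃ t : ℝ, 0 ≤ t ∧ ∃ u : ℝ, Y = NormedSpace.exp (t • (A + u • B))}

theorem exp_mem_flowMonoid (A B : Matrix (Fin N) (Fin N) ℂ) {t : ℝ} (ht : 0 ≤ t) (u : ℝ) :
    NormedSpace.exp (t • (A + u • B)) ∈ flowMonoid A B :=
  Submonoid.subset_closure ⟨t, ht, u, rfl⟩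

theorem add_smul_mem_su (hA : A ∈ su N) (hB : B ∈ su N) (u : ℝ) : A + u • B ∈ su N :=
  (suLie N).add_mem hA (smul_mem_su hB u)

theorem flowMonoid_le (hA : A ∈ su N) (hB : B ∈ su N) :
    flowMonoid A B ≤ specialUnitaryGroup (Fin N) ℂ := by
  refine Submonoid.closure_le.2 ?_
  rintro _ ⟨t, -, u, rfl⟩
  exact exp_mem_specialUnitaryGroup (smul_mem_su (add_smul_mem_su hA hB u) t)

theorem star_mul_self_of_mem {g : Matrix (Fin N) (Fin N) ℂ}
    (hg : g ∈ specialUnitaryGroup (Fin N) ℂ) : star g * g = 1 :=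
  mem_unitaryGroup_iff'.1 (mem_specialUnitaryGroup_iff.1 hg).1

theorem mul_star_self_of_mem {g : Matrix (Fin N) (Fin N) ℂ}
    (hg : g ∈ specialUnitaryGroup (Fin N) ℂ) : g * star g = 1 :=
  mem_unitaryGroup_iff.1 (mem_specialUnitaryGroup_iff.1 hg).1

theorem star_mem {g : Matrix (Fin N) (Fin N) ℂ}
    (hg : g ∈ specialUnitaryGroup (Fin N) ℂ) : star g ∈ specialUnitaryGroup (Fin N) ℂ :=
  (star (⟨g, hg⟩ : specialUnitaryGroup (Fin N) ℂ)).2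

/-- Conjugation by `s` as a real linear map: `X ↦ s* X s`. -/
noncomputable def starConj (s : Matrix (Fin N) (Fin N) ℂ) :
    Matrix (Fin N) (Fin N) ℂ →ₗ[ℝ] Matrix (Fin N) (Fin N) ℂ :=
  LinearMap.mulLeftRight ℝ (star s, s)

theorem starConj_apply (s X : Matrix (Fin N) (Fin N) ℂ) : starConj s X = star s * X * s := rfl

/-- The span of the directions `s* (A + u B) s` transported along the flow monoid. -/
noncomputable def transportedSpan (A B : Matrix (Fin N) (Fin N) ℂ) :
    Submodule ℝ (Matrix (Fin N) (Fin N) ℂ) :=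
  Submodule.span ℝ {X | ∃ s ∈ flowMonoid A B, ∃ u : ℝ, X = starConj s (A + u • B)}

theorem starConj_mem_transportedSpan {s X : Matrix (Fin N) (Fin N) ℂ} (hs : s ∈ flowMonoid A B)
    (hX : X ∈ transportedSpan A B) : starConj s X ∈ transportedSpan A B := by
  suffices transportedSpan A B ≤ (transportedSpan A B).comap (starConj s) from this hX
  refine Submodule.span_le.2 ?_
  rintro _ ⟨q, hq, u, rfl⟩
  refine Submodule.subset_span ⟨q * s, mul_mem hq hs, u, ?_⟩
  simp only [starConj_apply, star_mul, mul_assoc]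

theorem add_smul_mem_transportedSpan (A B : Matrix (Fin N) (Fin N) ℂ) (u : ℝ) :
    A + u • B ∈ transportedSpan A B :=
  Submodule.subset_span ⟨1, one_mem _, u, by simp [starConj_apply]⟩

/-- The derivative of exp(-tX) v exp(tX) at 0 is -[X,v]. Only t ≥ 0 is available, but a one-sided
limit suffices since a finite-dimensional subspace is closed. -/
theorem lie_mem_transportedSpan (hA : A ∈ su N) (hB : B ∈ su N) (u : ℝ)
    {v : Matrix (Fin N) (Fin N) ℂ} (hv : v ∈ transportedSpan A B) :
    ⁅A + u • B, v⁆ ∈ transportedSpan A B := by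
  set X := A + u • B
  have hX := add_smul_mem_su hA hB u
  have h1 : HasDerivAt (fun t : ℝ => NormedSpace.exp (t • X)) X 0 := by
    simpa using hasDerivAt_exp_smul_const' (𝕂 := ℝ) X 0
  have h2 : HasDerivAt (fun t : ℝ => NormedSpace.exp (t • -X)) (-X) 0 := by
    simpa using hasDerivAt_exp_smul_const' (𝕂 := ℝ) (-X) 0
  have h3 : HasDerivAt (fun t : ℝ => NormedSpace.exp (t • -X) * v * NormedSpace.exp (t • X))
      (v * X - X * v) 0 := by
    have := (h2.mul_const v).mul h1
    simp only [zero_smul, NormedSpace.exp_zero, one_mul, mul_one] at this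
    exact this.congr_deriv (by rw [neg_mul]; abel)
  have hclosed : IsClosed (transportedSpan A B : Set (Matrix (Fin N) (Fin N) ℂ)) :=
    Submodule.closed_of_finiteDimensional _
  have h4 : v * X - X * v ∈ transportedSpan A B := by
    refine hclosed.mem_of_tendsto h3.tendsto_slope_zero_right ?_
    filter_upwards [self_mem_nhdsWithin] with t ht
    refine Submodule.smul_mem _ _ (sub_mem ?_ (by simpa using hv))
    have h5 := starConj_mem_transportedSpan
      (exp_mem_flowMonoid A B (le_of_lt (Set.mem_Ioi.1 ht)) u) hv
    rw [starConj_apply, star_exp_of_skew (smul_mem_su hX t).1] at h5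
    simp only [smul_neg, zero_add]
    exact h5
  rw [Ring.lie_def, ← neg_sub]
  exact neg_mem h4

theorem su_subset_transportedSpan (hA : A ∈ su N) (hB : B ∈ su N)
    (hrank : su N ⊆ LieSubalgebra.lieSpan ℝ (Matrix (Fin N) (Fin N) ℂ) {A, B}) :
    su N ⊆ transportedSpan A B := by
  -- K is the stabiliser of the transported span, a Lie algebra by the Jacobi identity. It contains
  -- A and B, so brackets of generated elements remain in the span.
  let K : LieSubalgebra ℝ (Matrix (Fin N) (Fin N) ℂ) :=
    { carrier := {X | ∀ v ∈ transportedSpan A B, ⁅X, v⁆ ∈ transportedSpan A B}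
      zero_mem' := fun v _ => by simp
      add_mem' := fun hX hY v hv => by
        rw [add_lie]; exact add_mem (hX v hv) (hY v hv)
      smul_mem' := fun r X hX v hv => by
        rw [smul_lie]; exact Submodule.smul_mem _ r (hX v hv)
      lie_mem' := fun {X Y} hX hY v hv => by
        rw [lie_lie]; exact sub_mem (hX _ (hY v hv)) (hY _ (hX v hv)) }
  have hAV : A ∈ transportedSpan A B := by simpa using add_smul_mem_transportedSpan A B 0
  have hBV : B ∈ transportedSpan A B := by
    simpa using sub_mem (add_smul_mem_transportedSpan A B 1) hAV
  have hAK : A ∈ K := fun v hv => by simpa using lie_mem_transportedSpan hA hB 0 hv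
  have hBK : B ∈ K := by
    have : A + (1 : ℝ) • B ∈ K := fun v hv => lie_mem_transportedSpan hA hB 1 hv
    simpa using K.sub_mem this hAK
  have hLK : LieSubalgebra.lieSpan ℝ (Matrix (Fin N) (Fin N) ℂ) {A, B} ≤ K :=
    LieSubalgebra.lieSpan_le.2 (by rintro X (rfl | rfl) <;> assumption)
  intro X hX
  refine LieSubalgebra.lieSpan_induction (R := ℝ) (s := {A, B})
    (p := fun X _ => X ∈ transportedSpan A B) ?_ ?_ ?_ ?_ (hx := hrank hX) ?_
  · rintro Y (rfl | rfl) <;> assumption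
  · exact zero_mem _
  · intro _ _ _ _ h h'; exact add_mem h h'
  · intro a _ _ h; exact Submodule.smul_mem _ a h
  · intro Y Z hY _ _ h'; exact hLK hY Z h'

/-- A strictly differentiable family in `S` through `g` whose left-translated derivative at the
base point covers `W`. -/
def HasLocalParam (S : Submonoid (Matrix (Fin N) (Fin N) ℂ)) (g : Matrix (Fin N) (Fin N) ℂ)
    (W : Submodule ℝ (Matrix (Fin N) (Fin N) ℂ)) : Prop :=
  ∃ (F : Type) (_ : NormedAddCommGroup F) (_ : NormedSpace ℝ F) (_ : CompleteSpace F)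
    (φ : F → Matrix (Fin N) (Fin N) ℂ) (φ' : F →L[ℝ] Matrix (Fin N) (Fin N) ℂ),
    HasStrictFDerivAt φ φ' 0 ∧ φ 0 = g ∧ (∀ᶠ t in 𝓝 0, φ t ∈ S) ∧ ∀ w ∈ W, ∃ v, φ' v = g * w

theorem hasLocalParam_one (S : Submonoid (Matrix (Fin N) (Fin N) ℂ)) : HasLocalParam S 1 ⊥ :=
  ⟨ℝ, inferInstance, inferInstance, inferInstance, fun _ => 1, 0, hasStrictFDerivAt_const _ _, rfl,
    Filter.Eventually.of_forall fun _ => one_mem S, fun w hw => ⟨0, by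
      rw [(Submodule.mem_bot ℝ).1 hw]; simp⟩⟩

/-- Left multiplication does not change left-translated derivatives, so W survives; varying the time
of the last flow adds one direction. The base time is 1, not 0, so that small variations of either
sign still run forward. -/
theorem HasLocalParam.extend {g q : Matrix (Fin N) (Fin N) ℂ}
    {W : Submodule ℝ (Matrix (Fin N) (Fin N) ℂ)} (h : HasLocalParam (flowMonoid A B) g W)
    (hq : q ∈ flowMonoid A B) (u : ℝ) (hqg : q * g ∈ specialUnitaryGroup (Fin N) ℂ) :
    HasLocalParam (flowMonoid A B) (NormedSpace.exp (A + u • B) * (q * g))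
      (W ⊔ Submodule.span ℝ {starConj (q * g) (A + u • B)}) := by
  obtain ⟨F, _, _, _, φ, φ', hφ, rfl, hS, hW⟩ := h
  set X := A + u • B
  have hexp : HasStrictFDerivAt (fun p : F × ℝ => NormedSpace.exp ((1 + p.2) • X))
      ((ContinuousLinearMap.snd ℝ F ℝ).smulRight (NormedSpace.exp X * X)) 0 := by
    have h1 : HasStrictDerivAt (fun t : ℝ => NormedSpace.exp (t • X)) (NormedSpace.exp X * X)
        (1 + (0 : F × ℝ).2) := by
      simpa using hasStrictDerivAt_exp_smul_const (𝕂 := ℝ) X 1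
    have h2 : HasStrictFDerivAt (fun p : F × ℝ => 1 + p.2) (ContinuousLinearMap.snd ℝ F ℝ) 0 :=
      hasStrictFDerivAt_snd.const_add 1
    have h3 := h1.hasStrictFDerivAt.comp (0 : F × ℝ) h2
    exact h3.congr_fderiv (by ext <;> simp)
  have hφ2 : HasStrictFDerivAt (fun p : F × ℝ => q * φ p.1)
      (ContinuousLinearMap.mul ℝ _ q ∘L φ' ∘L ContinuousLinearMap.fst ℝ F ℝ) 0 :=
    (ContinuousLinearMap.mul ℝ _ q).hasStrictFDerivAt.comp (0 : F × ℝ)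
      (HasStrictFDerivAt.comp (0 : F × ℝ) (g := φ) hφ hasStrictFDerivAt_fst)
  refine ⟨F × ℝ, inferInstance, inferInstance, inferInstance, _, _, hexp.mul' hφ2, by simp, ?_, ?_⟩
  · have e1 : ∀ᶠ p : F × ℝ in 𝓝 0, φ p.1 ∈ flowMonoid A B :=
      (continuous_fst.tendsto (0 : F × ℝ)).eventually hS
    have e2 : ∀ᶠ p : F × ℝ in 𝓝 0, -1 < p.2 :=
      (continuous_snd.tendsto (0 : F × ℝ)).eventually (lt_mem_nhds (by simp))
    filter_upwards [e1, e2] with p h1 h2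
    exact mul_mem (exp_mem_flowMonoid A B (by linarith) u) (mul_mem hq h1)
  · intro w hw
    obtain ⟨w, hw', x, hx, rfl⟩ := Submodule.mem_sup.1 hw
    obtain ⟨c, rfl⟩ := Submodule.mem_span_singleton.1 hx
    obtain ⟨v, hv⟩ := hW w hw'
    refine ⟨(v, c), ?_⟩
    have hu := mul_star_self_of_mem hqg
    have hX : q * φ 0 * (star (q * φ 0) * X * (q * φ 0)) = X * (q * φ 0) := by
      rw [mul_assoc (star _), ← mul_assoc, hu, one_mul]
    simp only [starConj_apply, Prod.snd_zero, Prod.fst_zero, add_zero, one_smul,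
      _root_.add_apply, _root_.smul_apply, ContinuousLinearMap.comp_apply,
      ContinuousLinearMap.smulRight_apply, ContinuousLinearMap.coe_fst',
      ContinuousLinearMap.coe_snd', ContinuousLinearMap.mul_apply', hv, smul_eq_mul,
      MulOpposite.smul_eq_mul_unop, MulOpposite.unop_op]
    clear_value X
    rw [mul_assoc (NormedSpace.exp X) (q * φ 0), mul_add, mul_smul_comm, hX, mul_add, mul_smul_comm,
      smul_mul_assoc]
    simp only [mul_assoc]

/-- While W misses part of su(N), some transported direction lies outside W and the extension raises
its dimension; this cannot continue in finite dimension. -/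
theorem exists_hasLocalParam (hA : A ∈ su N) (hB : B ∈ su N)
    (hrank : su N ⊆ LieSubalgebra.lieSpan ℝ (Matrix (Fin N) (Fin N) ℂ) {A, B}) :
    ∃ g ∈ flowMonoid A B, ∃ W : Submodule ℝ (Matrix (Fin N) (Fin N) ℂ),
      HasLocalParam (flowMonoid A B) g W ∧ su N ⊆ W := by
  by_contra hcon
  push Not at hcon
  have key : ∀ n : ℕ, ∃ g ∈ flowMonoid A B, ∃ W : Submodule ℝ (Matrix (Fin N) (Fin N) ℂ),
      HasLocalParam (flowMonoid A B) g W ∧ n ≤ Module.finrank ℝ W := by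
    intro n
    induction n with
    | zero => exact ⟨1, one_mem _, ⊥, hasLocalParam_one _, Nat.zero_le _⟩
    | succ n ih =>
      obtain ⟨g, hg, W, hW, hn⟩ := ih
      have hgU := flowMonoid_le hA hB hg
      obtain ⟨q, hq, u, hqu⟩ : ∃ q ∈ flowMonoid A B, ∃ u : ℝ,
          starConj (q * g) (A + u • B) ∉ W := by
        by_contra hall
        push Not at hall
        refine hcon g hg W hW fun X hX => ?_
        -- If no extension enlarges W, it contains the g-conjugate of the transported span, hence of
        -- su(N), which conjugation by g preserves.
        have hV : transportedSpan A B ≤ W.comap (starConj g) := by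
          refine Submodule.span_le.2 ?_
          rintro _ ⟨q, hq, u, rfl⟩
          have := hall q hq u
          simp only [starConj_apply, star_mul, mul_assoc] at this
          simpa only [SetLike.mem_coe, Submodule.mem_comap, starConj_apply, mul_assoc] using this
        have hX' : g * X * star g ∈ su N := by
          constructor
          · rw [conjTranspose_mul, conjTranspose_mul, hX.1, star_eq_conjTranspose,
              conjTranspose_conjTranspose]
            simp [mul_assoc]
          · rw [trace_mul_comm, ← mul_assoc, star_mul_self_of_mem hgU, one_mul, hX.2]
        have := hV (su_subset_transportedSpan hA hB hrank hX')
        rw [Submodule.mem_comap, starConj_apply] at this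
        have h1 : star g * (g * X * star g) * g = (star g * g) * X * (star g * g) := by
          simp only [mul_assoc]
        rwa [h1, star_mul_self_of_mem hgU, one_mul, mul_one] at this
      refine ⟨_, mul_mem (by simpa using exp_mem_flowMonoid A B zero_le_one u) (mul_mem hq hg), _,
        hW.extend hq u (flowMonoid_le hA hB (mul_mem hq hg)), ?_⟩
      refine Nat.succ_le_of_lt (hn.trans_lt (Submodule.finrank_lt_finrank_of_lt ?_))
      refine lt_of_le_of_ne le_sup_left fun heq => hqu ?_
      rw [heq]
      exact Submodule.mem_sup_right (Submodule.mem_span_singleton_self _)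
  obtain ⟨g, -, W, -, hn⟩ := key (Module.finrank ℝ (Matrix (Fin N) (Fin N) ℂ) + 1)
  have := Submodule.finrank_le W
  omega

end FlowMonoid

/-! ### From a local parametrization to all of SU(N) -/

section Openness

open scoped Matrix.Norms.L2Operator Topology

variable {N : ℕ}

/-- Here (1 + P)² = 1 gives P² = -2P, so ‖P‖² = 2‖P‖, and a norm below 1 must be 0. -/
theorem eq_zero_of_one_add_mem_unitaryGroup {P : Matrix (Fin N) (Fin N) ℂ} (hP : star P = P)
    (hU : 1 + P ∈ unitaryGroup (Fin N) ℂ) (hlt : ‖P‖ < 1) : P = 0 := by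
  have h1 := mem_unitaryGroup_iff'.1 hU
  rw [star_add, star_one, hP] at h1
  have h2 : P * P = (-2 : ℝ) • P := by
    have : P * P = (1 + P) * (1 + P) - 1 - (2 : ℝ) • P := by
      rw [two_smul]; noncomm_ring
    rw [this, h1]; simp
  have h3 : ‖P‖ * ‖P‖ = 2 * ‖P‖ := by
    have := CStarRing.norm_star_mul_self (x := P)
    rw [hP, h2, norm_smul] at this
    rw [← this]; norm_num
  have h4 : ‖P‖ = 0 := by nlinarith [norm_nonneg P]
  exact norm_eq_zero.1 h4

/-- The scalar skew-Hermitian matrix `i`. -/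
noncomputable def scalarI (N : ℕ) : Matrix (Fin N) (Fin N) ℂ := Complex.I • 1

theorem scalarI_skew (θ : ℝ) : (θ • scalarI N)ᴴ = -(θ • scalarI N) := by
  simp [scalarI, conjTranspose_smul]

theorem trace_smul_scalarI (θ : ℝ) : (θ • scalarI N).trace = (θ * N : ℝ) * Complex.I := by
  simp [scalarI, trace_smul, trace_one]; ring

/-- `gl(N, ℂ) = su(N) ⊕ iℝ ⊕ {Hermitian matrices}`. -/
theorem exists_su_decomposition (hN : N ≠ 0) (Z : Matrix (Fin N) (Fin N) ℂ) :
    ∃ X ∈ su N, ∃ (θ : ℝ) (P : Matrix (Fin N) (Fin N) ℂ), Z = X + θ • scalarI N + (P + star P) := by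
  have hN' : (N : ℂ) ≠ 0 := by exact_mod_cast hN
  set K : Matrix (Fin N) (Fin N) ℂ := (2⁻¹ : ℝ) • (Z - star Z)
  have hK : Kᴴ = -K := by
    simp only [K, star_eq_conjTranspose, conjTranspose_smul, conjTranspose_sub,
      conjTranspose_conjTranspose, star_trivial, ← smul_neg, neg_sub]
  set θ : ℝ := K.trace.im / N
  have hre : K.trace.re = 0 := by
    have : star K.trace = -K.trace := by rw [← trace_conjTranspose, hK, trace_neg]
    have := congrArg Complex.re this
    simp at this; linarith
  -- P is a quarter of Z + Z*, so that P + P* is the Hermitian part of Z.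
  refine ⟨K - θ • scalarI N, ⟨?_, ?_⟩, θ, (2⁻¹ : ℝ) • ((2⁻¹ : ℝ) • (Z + star Z)), ?_⟩
  · rw [conjTranspose_sub, hK, scalarI_skew]; abel
  · rw [trace_sub, trace_smul_scalarI]
    have : θ * N = K.trace.im := div_mul_cancel₀ _ (by exact_mod_cast hN)
    rw [this]
    apply Complex.ext <;> simp [hre]
  · simp only [K, star_smul, star_add, star_star, star_trivial]
    module

/-- If the local parametrization covers `su(N)`, then `S` contains a neighbourhood of `g`
in `SU(N)`. -/
theorem HasLocalParam.exists_ball {S : Submonoid (Matrix (Fin N) (Fin N) ℂ)}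
    (hN : N ≠ 0) (hSU : S ≤ specialUnitaryGroup (Fin N) ℂ) {g : Matrix (Fin N) (Fin N) ℂ}
    (hg : g ∈ S) {W : Submodule ℝ (Matrix (Fin N) (Fin N) ℂ)} (h : HasLocalParam S g W)
    (hW : su N ⊆ W) :
    ∃ ε > 0, ∀ x ∈ specialUnitaryGroup (Fin N) ℂ, ‖x - g‖ < ε → x ∈ S := by
  obtain ⟨F, _, _, _, φ, φ', hφ, rfl, hS, hφW⟩ := h
  -- The family is padded to (t, Z, θ) ↦ φ(t) exp(iθ)(1 + Z + Z*), whose derivative is onto the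
  -- whole matrix space, so it maps neighbourhoods of 0 onto neighbourhoods of g. Values in SU(N)
  -- will force Z + Z* = 0 and θ = 0, leaving φ(t) in S.
  let hermL : Matrix (Fin N) (Fin N) ℂ →L[ℝ] Matrix (Fin N) (Fin N) ℂ :=
    ContinuousLinearMap.id ℝ _ +
      ((starL' ℝ : _ ≃L[ℝ] Matrix (Fin N) (Fin N) ℂ) : _ →L[ℝ] Matrix (Fin N) (Fin N) ℂ)
  have hherm : ∀ Z, hermL Z = Z + star Z := fun Z => rfl
  let prθ : F × Matrix (Fin N) (Fin N) ℂ × ℝ →L[ℝ] ℝ :=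
    ContinuousLinearMap.snd ℝ _ ℝ ∘L ContinuousLinearMap.snd ℝ F _
  let prP : F × Matrix (Fin N) (Fin N) ℂ × ℝ →L[ℝ] Matrix (Fin N) (Fin N) ℂ :=
    hermL ∘L ContinuousLinearMap.fst ℝ _ ℝ ∘L ContinuousLinearMap.snd ℝ F _
  have e1 : HasStrictFDerivAt (fun p : F × Matrix (Fin N) (Fin N) ℂ × ℝ => φ p.1)
      (φ' ∘L ContinuousLinearMap.fst ℝ F _) 0 :=
    HasStrictFDerivAt.comp (0 : F × Matrix (Fin N) (Fin N) ℂ × ℝ) (g := φ) hφ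
      hasStrictFDerivAt_fst
  have e2 : HasStrictFDerivAt (fun p : F × Matrix (Fin N) (Fin N) ℂ × ℝ => 1 + hermL p.2.1)
      prP 0 :=
    prP.hasStrictFDerivAt.const_add 1
  have e3 : HasStrictFDerivAt
      (fun p : F × Matrix (Fin N) (Fin N) ℂ × ℝ => NormedSpace.exp (p.2.2 • scalarI N))
      (prθ.smulRight (scalarI N)) 0 := by
    have h1 : HasStrictDerivAt (fun t : ℝ => NormedSpace.exp (t • scalarI N)) (scalarI N)
        (prθ 0) := by
      simpa using hasStrictDerivAt_exp_smul_const (𝕂 := ℝ) (scalarI N) 0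
    have h3 := h1.hasStrictFDerivAt.comp (0 : F × Matrix (Fin N) (Fin N) ℂ × ℝ)
      prθ.hasStrictFDerivAt
    exact h3.congr_fderiv (by ext <;> simp)
  have e4 := (e1.mul' e3).mul' e2
  have hgU := hSU hg
  have hsurj := e4.map_nhds_eq_of_surj (by
    refine LinearMap.range_eq_top.2 fun Y => ?_
    obtain ⟨X, hX, θ, P, hZ⟩ := exists_su_decomposition hN (star (φ 0) * Y)
    obtain ⟨v, hv⟩ := hφW X (hW hX)
    refine ⟨(v, P, θ), ?_⟩
    have hY : Y = φ 0 * X + θ • (φ 0 * scalarI N) + φ 0 * (P + star P) := by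
      rw [← mul_smul_comm, ← mul_add, ← mul_add, ← hZ, ← mul_assoc, mul_star_self_of_mem hgU,
        one_mul]
    rw [hY]
    simp [hv, hherm, prθ, prP]
    abel)
  have hmem :
      {p : F × Matrix (Fin N) (Fin N) ℂ × ℝ |
        φ p.1 ∈ S ∧ ‖hermL p.2.1‖ < 1 ∧ |p.2.2 * N| < 1} ∈ 𝓝 0 := by
    have c1 : ∀ᶠ p : F × Matrix (Fin N) (Fin N) ℂ × ℝ in 𝓝 0, φ p.1 ∈ S :=
      (continuous_fst.tendsto (0 : F × Matrix (Fin N) (Fin N) ℂ × ℝ)).eventually hS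
    have c2 : ∀ᶠ p : F × Matrix (Fin N) (Fin N) ℂ × ℝ in 𝓝 0, ‖hermL p.2.1‖ < 1 := by
      have : Continuous fun p : F × Matrix (Fin N) (Fin N) ℂ × ℝ => ‖hermL p.2.1‖ := by fun_prop
      exact (this.tendsto 0).eventually (gt_mem_nhds (by simp))
    have c3 : ∀ᶠ p : F × Matrix (Fin N) (Fin N) ℂ × ℝ in 𝓝 0, |p.2.2 * N| < 1 := by
      have : Continuous fun p : F × Matrix (Fin N) (Fin N) ℂ × ℝ => |p.2.2 * N| := by fun_prop
      exact (this.tendsto 0).eventually (gt_mem_nhds (by simp))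
    filter_upwards [c1, c2, c3] with p h1 h2 h3 using ⟨h1, h2, h3⟩
  have himg := hsurj ▸ Filter.image_mem_map hmem
  obtain ⟨ε, hε, hball⟩ := Metric.mem_nhds_iff.1 himg
  refine ⟨ε, hε, fun x hx hxg => ?_⟩
  obtain ⟨⟨t, Z, θ⟩, ⟨h1, h2, h3⟩, hxe⟩ := hball (by
    simpa [dist_eq_norm] using hxg)
  simp only [Pi.mul_apply] at h1 h2 h3 hxe
  set e := NormedSpace.exp (θ • scalarI N)
  have he : e ∈ unitaryGroup (Fin N) ℂ := exp_mem_unitaryGroup (scalarI_skew θ)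
  have hφt := mem_specialUnitaryGroup_iff.1 (hSU h1)
  have hx' := mem_specialUnitaryGroup_iff.1 hx
  have hu : φ t * e ∈ unitaryGroup (Fin N) ℂ := mul_mem hφt.1 he
  have hZ0 : hermL Z = 0 := by
    refine eq_zero_of_one_add_mem_unitaryGroup (by simp [hherm, add_comm]) ?_ h2
    have : 1 + hermL Z = star (φ t * e) * x := by
      rw [← hxe, ← mul_assoc, mem_unitaryGroup_iff'.1 hu, one_mul]
    rw [this]
    exact mul_mem (Unitary.star_mem hu) hx'.1
  rw [hZ0, add_zero, mul_one] at hxe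
  have hdet : e.det = 1 := by
    have := congrArg det hxe
    rwa [det_mul, hφt.2, hx'.2, one_mul] at this
  have hθ : θ = 0 := by
    rw [det_exp_of_skew (scalarI_skew θ), trace_smul_scalarI, Complex.exp_eq_one_iff] at hdet
    obtain ⟨m, hm⟩ := hdet
    have hm' : θ * N = m * (2 * Real.pi) := by
      have := congrArg Complex.im hm
      simpa using this
    -- The determinant gives θN ∈ 2πℤ, while |θN| < 1.
    have hm0 : m = 0 := by
      by_contra hne
      have : (1 : ℝ) ≤ |(m : ℝ)| := by exact_mod_cast Int.one_le_abs hne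
      rw [hm', abs_mul, abs_of_pos Real.two_pi_pos] at h3
      nlinarith [Real.pi_gt_three]
    rw [hm0, Int.cast_zero, zero_mul] at hm'
    exact (mul_eq_zero.1 hm').resolve_right (by exact_mod_cast hN)
  have : e = 1 := by simp [e, hθ]
  rw [← hxe, this, mul_one]
  exact h1

theorem norm_mul_of_mem {U : Matrix (Fin N) (Fin N) ℂ}
    (hU : U ∈ specialUnitaryGroup (Fin N) ℂ) (X : Matrix (Fin N) (Fin N) ℂ) : ‖U * X‖ = ‖X‖ :=
  CStarRing.norm_mem_unitary_mul X (mem_specialUnitaryGroup_iff.1 hU).1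

/-- Powers of a special unitary matrix return arbitrarily close to the identity. -/
theorem exists_norm_pow_sub_one_lt {g : Matrix (Fin N) (Fin N) ℂ}
    (hg : g ∈ specialUnitaryGroup (Fin N) ℂ) {ε : ℝ} (hε : 0 < ε) :
    ∃ n : ℕ, ‖g ^ (n + 1) - 1‖ < ε := by
  have : ProperSpace (Matrix (Fin N) (Fin N) ℂ) := FiniteDimensional.proper ℂ _
  have hbdd : Bornology.IsBounded (Set.range fun n : ℕ => g ^ n) := by
    refine isBounded_iff_forall_norm_le.2 ⟨‖(1 : Matrix (Fin N) (Fin N) ℂ)‖, ?_⟩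
    rintro _ ⟨n, rfl⟩
    rw [← norm_mul_of_mem (pow_mem hg n) 1, mul_one]
  obtain ⟨a, -, ψ, hψ, hlim⟩ := tendsto_subseq_of_bounded hbdd fun n => Set.mem_range_self n
  obtain ⟨k, hk⟩ := Metric.cauchySeq_iff'.1 hlim.cauchySeq ε hε
  have h1 := hk (k + 1) (Nat.le_succ k)
  -- The return exponent m + 1 is the gap ψ(k+1) - ψ(k); cancelling g^ψ(k) is isometric.
  obtain ⟨m, hm⟩ := Nat.exists_eq_add_of_lt (hψ (Nat.lt_succ_self k))
  refine ⟨m, ?_⟩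
  rw [dist_eq_norm] at h1
  rw [← norm_mul_of_mem (pow_mem hg (ψ k)), mul_sub, mul_one, ← pow_add, ← add_assoc, ← hm]
  exact h1

/-- A submonoid of `SU(N)` with an interior point is all of `SU(N)`. -/
theorem specialUnitaryGroup_le_of_ball {S : Submonoid (Matrix (Fin N) (Fin N) ℂ)}
    (hSU : S ≤ specialUnitaryGroup (Fin N) ℂ) {g : Matrix (Fin N) (Fin N) ℂ} (hg : g ∈ S)
    {ε : ℝ} (hε : 0 < ε)
    (hball : ∀ x ∈ specialUnitaryGroup (Fin N) ℂ, ‖x - g‖ < ε → x ∈ S) :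
    specialUnitaryGroup (Fin N) ℂ ≤ S := by
  obtain ⟨n, hn⟩ := exists_norm_pow_sub_one_lt (hSU hg) (half_pos hε)
  -- As g^(n+1) is near 1, g⁻ⁿx is near g for x near 1, hence in S; multiplying back by gⁿ ∈ S
  -- recovers x without inverses in S.
  have hone : ∀ x ∈ specialUnitaryGroup (Fin N) ℂ, ‖x - 1‖ < ε / 2 → x ∈ S := by
    intro x hx hx1
    have hgn := pow_mem (hSU hg) n
    have hy : star (g ^ n) * x ∈ S := by
      refine hball _ (mul_mem (star_mem hgn) hx) ?_
      rw [← norm_mul_of_mem hgn, mul_sub, ← mul_assoc, mul_star_self_of_mem hgn, one_mul,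
        ← pow_succ]
      calc ‖x - g ^ (n + 1)‖ = ‖(x - 1) - (g ^ (n + 1) - 1)‖ := by congr 1; abel
        _ ≤ ‖x - 1‖ + ‖g ^ (n + 1) - 1‖ := norm_sub_le _ _
        _ < ε := by linarith
    have := mul_mem (pow_mem hg n) hy
    rwa [← mul_assoc, mul_star_self_of_mem hgn, one_mul] at this
  have hexp : ∀ X ∈ su N, NormedSpace.exp X ∈ S := by
    intro X hX
    have hcont : Continuous fun t : ℝ => NormedSpace.exp (t • X) :=
      continuous_iff_continuousAt.2 fun t =>
        (hasDerivAt_exp_smul_const' (𝕂 := ℝ) X t).continuousAt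
    have hlim : Filter.Tendsto (fun n : ℕ => NormedSpace.exp ((1 / ((n : ℝ) + 1)) • X))
        Filter.atTop (𝓝 1) := by
      have := (hcont.tendsto 0).comp (tendsto_one_div_add_atTop_nhds_zero_nat (𝕜 := ℝ))
      rwa [zero_smul, NormedSpace.exp_zero] at this
    -- exp X is the (m+1)-st power of exp(X/(m+1)), which is close to 1.
    obtain ⟨m, hm⟩ := (hlim.eventually (Metric.ball_mem_nhds 1 (half_pos hε))).exists
    rw [dist_eq_norm] at hm
    have h1 := hone _ (exp_mem_specialUnitaryGroup (smul_mem_su hX _)) hm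
    have h2 := pow_mem h1 (m + 1)
    rw [← Matrix.exp_nsmul, ← Nat.cast_smul_eq_nsmul ℝ, smul_smul] at h2
    have h3 : ((m + 1 : ℕ) : ℝ) * (1 / ((m : ℝ) + 1)) = 1 := by
      push_cast; field_simp
    rwa [h3, one_smul] at h2
  intro U hU
  obtain ⟨X, hX, Y, hY, rfl⟩ := exists_su_exp_mul_exp_eq hU
  exact mul_mem (hexp X hX) (hexp Y hY)

/-- Under the Lie algebra rank condition the forward flows generate `SU(N)` as a monoid. -/
theorem flowMonoid_eq {A B : Matrix (Fin N) (Fin N) ℂ} (hN : N ≠ 0) (hA : A ∈ su N)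
    (hB : B ∈ su N)
    (hrank : su N ⊆ LieSubalgebra.lieSpan ℝ (Matrix (Fin N) (Fin N) ℂ) {A, B}) :
    flowMonoid A B = specialUnitaryGroup (Fin N) ℂ := by
  obtain ⟨g, hg, W, hW, hsu⟩ := exists_hasLocalParam hA hB hrank
  obtain ⟨ε, hε, hball⟩ := hW.exists_ball hN (flowMonoid_le hA hB) hg hsu
  exact le_antisymm (flowMonoid_le hA hB)
    (specialUnitaryGroup_le_of_ball (flowMonoid_le hA hB) hg hε hball)

end Openness

/-! ### Concatenating trajectories -/

section Reachability

variable {N : ℕ} {A B : Matrix (Fin N) (Fin N) ℂ}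

theorem IsAdmissible.piecewise {u : ℝ → ℝ} (hu : IsAdmissible u) (T c : ℝ) :
    IsAdmissible fun s => if s ≤ T then u s else c := by
  obtain ⟨S, hS⟩ := hu
  refine ⟨insert T S, fun s t hst h => ?_⟩
  have hT : T ∉ Set.Icc s t := h T (Finset.mem_insert_self _ _)
  have hu' := hS s t hst fun r hr => h r (Finset.mem_insert_of_mem hr)
  by_cases ht : t ≤ T
  · simp only [ht, hst.trans ht, if_true, hu']
  · have hs : ¬ s ≤ T := fun hs => hT ⟨hs, (not_le.1 ht).le⟩
    simp only [ht, hs, if_false]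

theorem one_mem_reachableSet (A B : Matrix (Fin N) (Fin N) ℂ) :
    (1 : specialUnitaryGroup (Fin N) ℂ) ∈ reachableSet A B :=
  ⟨fun _ => 0, ⟨∅, fun _ _ _ _ => rfl⟩, 0, le_rfl, fun _ => 1,
    ⟨rfl, continuousOn_const, ∅, fun _ ht => absurd (ht.1.trans ht.2) (lt_irrefl _)⟩, rfl⟩

section
open scoped Matrix.Norms.L2Operator

theorem continuous_exp_sub_smul (X : Matrix (Fin N) (Fin N) ℂ) (T : ℝ) :
    Continuous fun s : ℝ => NormedSpace.exp ((s - T) • X) :=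
  (continuous_iff_continuousAt.2 fun t =>
    (hasDerivAt_exp_smul_const' (𝕂 := ℝ) X t).continuousAt).comp
      (continuous_id.sub continuous_const)

theorem hasDerivAt_exp_sub_smul_mul_apply (X Y : Matrix (Fin N) (Fin N) ℂ) (T t : ℝ)
    (i j : Fin N) :
    HasDerivAt (fun s : ℝ => (NormedSpace.exp ((s - T) • X) * Y) i j)
      ((X * (NormedSpace.exp ((t - T) • X) * Y)) i j) t := by
  have h1 : HasDerivAt (fun s : ℝ => NormedSpace.exp ((s - T) • X) * Y)
      (X * NormedSpace.exp ((t - T) • X) * Y) t :=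
    ((hasDerivAt_exp_smul_const' (𝕂 := ℝ) X (t - T)).comp_sub_const t T).mul_const Y
  rw [mul_assoc] at h1
  let ev : Matrix (Fin N) (Fin N) ℂ →L[ℝ] ℂ := LinearMap.toContinuousLinearMap
    { toFun := fun M => M i j, map_add' := fun _ _ => rfl, map_smul' := fun _ _ => rfl }
  exact ev.hasFDerivAt.comp_hasDerivAt t h1

end

/-- Reachable points can be moved further along any constant-input flow. -/
theorem exp_mul_mem_reachableSet (hA : A ∈ su N) (hB : B ∈ su N)
    {Y : specialUnitaryGroup (Fin N) ℂ} (hY : Y ∈ reachableSet A B) {τ : ℝ} (hτ : 0 ≤ τ) (c : ℝ)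
    (Z : specialUnitaryGroup (Fin N) ℂ)
    (hZ : (Z : Matrix (Fin N) (Fin N) ℂ) = NormedSpace.exp (τ • (A + c • B)) * Y) :
    Z ∈ reachableSet A B := by
  obtain ⟨u, hu, T, hT, X, ⟨hX0, hXc, S, hXd⟩, rfl⟩ := hY
  have hmem : ∀ s : ℝ, NormedSpace.exp ((s - T) • (A + c • B)) ∈ specialUnitaryGroup (Fin N) ℂ :=
    fun s => exp_mem_specialUnitaryGroup (smul_mem_su (add_smul_mem_su hA hB c) _)
  let Φ : ℝ → specialUnitaryGroup (Fin N) ℂ := fun s => ⟨_, hmem s⟩ * X T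
  have hΦc : Continuous Φ := by
    refine Continuous.subtype_mk ?_ _
    exact (continuous_exp_sub_smul _ T).matrix_mul continuous_const
  have hΦT : Φ T = X T := Subtype.ext (by simp [Φ])
  let X' : ℝ → specialUnitaryGroup (Fin N) ℂ := fun s => if s ≤ T then X s else Φ s
  have hX'1 : ∀ s ≤ T, X' s = X s := fun s hs => if_pos hs
  have hX'2 : ∀ s, T ≤ s → X' s = Φ s := fun s hs => by
    rcases hs.eq_or_lt with rfl | hs
    · rw [hX'1 _ le_rfl, hΦT]
    · exact if_neg hs.not_ge
  -- The junction time T joins the exceptional set, since the glued curve may have a corner there.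
  refine ⟨_, hu.piecewise T c, T + τ, by positivity, X', ⟨?_, ?_, insert T S, ?_⟩, ?_⟩
  · rw [hX'1 0 hT, hX0]
  · rw [← Set.Icc_union_Icc_eq_Icc hT (by linarith : T ≤ T + τ)]
    exact (hXc.congr fun s hs => hX'1 s hs.2).union_of_isClosed
      (hΦc.continuousOn.congr fun s hs => hX'2 s hs.1) isClosed_Icc isClosed_Icc
  · intro t ht htS i j
    rw [Finset.mem_insert, not_or] at htS
    rcases lt_or_gt_of_ne htS.1 with h | h
    · rw [hX'1 t h.le]
      simp only [h.le, if_true]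
      refine (hXd t ⟨ht.1, h⟩ htS.2 i j).congr_of_eventuallyEq ?_
      filter_upwards [gt_mem_nhds h] with s hs
      rw [hX'1 s (le_of_lt hs)]
    · rw [hX'2 t h.le]
      simp only [h.not_ge, if_false]
      have := hasDerivAt_exp_sub_smul_mul_apply (A + c • B) (X T).1 T t i j
      refine HasDerivAt.congr_of_eventuallyEq (f := fun s => (Φ s).1 i j) ?_ ?_
      · have hc : (c : ℂ) • B = c • B := Complex.coe_smul c B
        rw [hc]
        exact this
      · filter_upwards [lt_mem_nhds h] with s hs
        rw [hX'2 s (le_of_lt hs)]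
  · rw [hX'2 _ (by linarith)]
    refine Subtype.ext ?_
    rw [hZ]
    simp [Φ]

theorem mem_reachableSet_of_mem_flowMonoid (hA : A ∈ su N) (hB : B ∈ su N)
    {Y : specialUnitaryGroup (Fin N) ℂ} (hY : (Y : Matrix (Fin N) (Fin N) ℂ) ∈ flowMonoid A B) :
    Y ∈ reachableSet A B := by
  suffices ∀ M : Matrix (Fin N) (Fin N) ℂ, M ∈ flowMonoid A B →
      ∀ h : M ∈ specialUnitaryGroup (Fin N) ℂ,
        (⟨M, h⟩ : specialUnitaryGroup (Fin N) ℂ) ∈ reachableSet A B from this _ hY Y.2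
  intro M hM
  -- Induction is on the left because the latest flow multiplies on the left.
  refine Submonoid.closure_induction_left (motive := fun M _ =>
    ∀ h : M ∈ specialUnitaryGroup (Fin N) ℂ,
      (⟨M, h⟩ : specialUnitaryGroup (Fin N) ℂ) ∈ reachableSet A B) ?_ ?_ hM
  · exact fun _ => one_mem_reachableSet A B
  · rintro _ ⟨t, ht, u, rfl⟩ Y hY ih h
    exact exp_mul_mem_reachableSet hA hB (ih (flowMonoid_le hA hB hY)) ht u _ rfl

/-- The Lie algebra rank condition implies controllability. -/
theorem isControllable_of_su_subset_lieSpan (hN : N ≠ 0) (hA : A ∈ su N) (hB : B ∈ su N)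
    (hrank : su N ⊆ LieSubalgebra.lieSpan ℝ (Matrix (Fin N) (Fin N) ℂ) {A, B}) :
    IsControllable A B :=
  Set.eq_univ_of_forall fun Y => mem_reachableSet_of_mem_flowMonoid hA hB
    (by rw [flowMonoid_eq hN hA hB hrank]; exact Y.2)

end Reachability

end QuantumControl

theorem mainTheorem8 {N : ℕ} (E : Fin N → ℝ) (B : Matrix (Fin N) (Fin N) ℂ)
    (hE_trace : ∑ k, E k = 0) (hE_order : Monotone E)
    (hE_nondeg : ∀ i j : Fin N, i ≠ j → E i ≠ E j)
    (hB : B ∈ QuantumControl.su N)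
    (hG : (QuantumControl.graph B).Connected) :
    QuantumControl.levelTwoDiag (QuantumControl.drift E) B
        = Complex.I • Matrix.diagonal (fun k => (QuantumControl.dEntry E B k : ℂ)) ∧
    (QuantumControl.IsRegular (QuantumControl.levelTwoDiag (QuantumControl.drift E) B) →
      QuantumControl.IsControllable (QuantumControl.drift E) B) ∧
    (QuantumControl.IsRegularAlong B
        (QuantumControl.levelTwoDiag (QuantumControl.drift E) B) →
      QuantumControl.IsControllable (QuantumControl.drift E) B) ∧
    (QuantumControl.IsRegularAlong (QuantumControl.levelOne (QuantumControl.drift E) B)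
        (QuantumControl.levelTwoDiag (QuantumControl.drift E) B) →
      QuantumControl.IsControllable (QuantumControl.drift E) B) := by
  have hinj : Function.Injective E := fun i j h => by
    by_contra hij
    exact hE_nondeg i j hij h
  have hN : N ≠ 0 := by
    rintro rfl
    exact hG.nonempty.elim fun i => i.elim0
  have hmain : QuantumControl.IsRegularAlong B
      (QuantumControl.levelTwoDiag (QuantumControl.drift E) B) →
      QuantumControl.IsControllable (QuantumControl.drift E) B := fun hreg =>
    QuantumControl.isControllable_of_su_subset_lieSpan hN (QuantumControl.drift_mem_su hE_trace) hB
      (QuantumControl.su_subset_lieSpan hE_trace (hE_order.strictMono_of_injective hinj) hB hG hreg)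
  refine ⟨QuantumControl.levelTwoDiag_drift E hB.1,
    fun h => hmain (QuantumControl.isRegularAlong_of_isRegular h), hmain, fun h => hmain ?_⟩
  rwa [QuantumControl.IsRegularAlong, QuantumControl.posRoots_levelOne hinj] at h
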